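/- Let $\mathbb N=\{1,2,3,\dots\}$ and let $\|x\|$ denote the distance from a real number $x$ to the nearest integer. Define $\partial:\bigcup_{\ell\in\mathbb N}\mathbb Z^{2^\ell}\to\mathbb Z$ recursively by $\partial(m_1,m_2)=m_2-m_1$ and, for $\ell>1$, $\partial(m_1,\dots,m_{2^\ell})=\partial(m_{2^{\ell-1}+1},\dots,m_{2^\ell})-\partial(m_1,\dots,m_{2^{\ell-1}})$. For $\ell\in\mathbb N$, a set $E\subseteq\mathbb N$ is called $\Delta_\ell^*$ if for every strictly increasing sequence $(n_k)_{k\in\mathbb N}$ in $\mathbb N$ there exist $k_1<k_2<\cdots<k_{2^\ell}$ such that $\partial(n_{k_1},\dots,n_{k_{2^\ell}})\in E$. A real polynomial is called odd if it is of the form $\sum_{j=1}^{m}a_jx^{2j-1}$ with real $a_j$. **Theorem.** Let $\ell\in\mathbb N$ and let $v(x)$ be an odd real polynomial with irrational leading coefficient. If for each $\epsilon>0$ the set $$\mathcal R(v,\epsilon)=\{n\in\mathbb N : \|v(n)\|<\epsilon\}$$ is $\Delta_\ell^*$, then $\deg(v)\le 2\ell-1$. -/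

import Mathlib

/-- The iterated difference `∂ : ℤ ^ (2 ^ ℓ) → ℤ`: `∂ (m₁, m₂) = m₂ - m₁`, and `∂` of a tuple of
length `2 ^ (ℓ + 1)` is `∂` of its second half minus `∂` of its first half. It is started at `ℓ = 0`
with the identity, which gives `m₂ - m₁` at `ℓ = 1`. -/
def iterDiff : (ℓ : ℕ) → (Fin (2 ^ ℓ) → ℤ) → ℤ
  | 0, m => m ⟨0, by simp⟩
  | ℓ + 1, m =>
      iterDiff ℓ (fun i => m ⟨2 ^ ℓ + i.val, by have := i.isLt; rw [pow_succ]; omega⟩)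
        - iterDiff ℓ (fun i => m ⟨i.val, by have := i.isLt; rw [pow_succ]; omega⟩)

/-- A set `E` of positive integers is `Δ_ℓ^*` if for every (strictly) increasing sequence `(n_k)` of
positive integers there are indices `k₁ < ⋯ < k_{2 ^ ℓ}` with `∂ (n_{k₁}, …, n_{k_{2 ^ ℓ}}) ∈ E`. -/
def IsDeltaStar (ℓ : ℕ) (E : Set ℕ+) : Prop :=
  ∀ n : ℕ → ℕ+, StrictMono n →
    ∃ k : Fin (2 ^ ℓ) → ℕ, StrictMono k ∧
      ∃ e ∈ E, ((e : ℕ) : ℤ) = iterDiff ℓ (fun i => ((n (k i) : ℕ) : ℤ))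

/-- The distance from a real number to the nearest integer. -/
noncomputable def distNearestInt (x : ℝ) : ℝ := |x - (round x : ℝ)|

/-- `R(v, ε)`: the set of positive integers `n` for which `v n` is at distance less than `ε` from
the nearest integer. -/
def returnSet (v : Polynomial ℝ) (ε : ℝ) : Set ℕ+ :=
  {n | distNearestInt (v.eval ((n : ℕ) : ℝ)) < ε}

/-- Odd real polynomials: those of the form `∑_{j = 1}^{m} a_j x ^ (2 j - 1)`. -/
def IsOddPolynomial (v : Polynomial ℝ) : Prop :=
  ∃ (m : ℕ) (a : ℕ → ℝ),
    v = ∑ j ∈ Finset.Icc 1 m, Polynomial.C (a j) * Polynomial.X ^ (2 * j - 1)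

/-!
Write `d = 2 h + 1` for the degree of `v` and suppose `h ≥ ℓ`. Powers `n ^ j` act on `ℝ / ℤ` by
multiplication, and these actions can be given prescribed limits: if `φ j : ℝ → ℝ`, for `j ≥ 1`, are
`ℚ`-linear maps vanishing on `ℚ`, then along a suitable nontrivial filter of integers, finer than
`atTop`, `n ^ j * a` tends to `φ j a` modulo `1` for all `a` and `j` (`powerFilter_neBot`). This is a
simultaneous form of Weyl's equidistribution theorem (`exists_fourierChar_pow_mul_close`).

Taking iterated limits along this filter, one variable after the other, the value of `v` at the
iterated difference of order `ℓ` tends modulo `1` to `∑ j, diffLimit φ ℓ j (a j)`, with `a j` the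
coefficients of `v` and `diffLimit φ ℓ j` a noncommutative polynomial in the `φ i` given by the
binomial recursion for `(y - x) ^ j` (`tendsto_fourierChar_listDiff`).

It remains to choose `φ` so that this limit is not an integer. Let only `φ 2 = E` and `φ c = O` be
nonzero, besides `φ 0 = 1`, where `c = d - 2 ℓ` is odd, and let `O * E = O * O = 0`. Then
`diffLimit φ ℓ j`, for odd `j = c + 2 i`, is a nonnegative multiple of `E ^ i * O`, a positive one
for `i = ℓ` (`exists_diffLimit_coeff`). On a Hamel basis one can choose `E` and `O` such that `O`
sends the leading coefficient to the beginning of a chain of length `ℓ` along which `E` shifts, and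
such that the coordinate at the end of the chain vanishes on `ℚ` (`exists_shift`). The coordinate of
the limit is then nonzero, because only the leading term of `v` reaches the end of the chain.

Since the iterated limit is nonzero modulo `1`, there is an increasing sequence of positive integers
at all of whose iterated differences `v` stays away from the integers
(`exists_strictMono_of_eventually_listFilter`), so some `returnSet v ε` is not `Δ_ℓ^*`.
-/

open Filter Topology Polynomial

/-! ### Van der Corput's inequality -/

/-- The Cesàro mean of the first `N` terms of a complex sequence. -/
noncomputable def cesaroMean (u : ℕ → ℂ) (N : ℕ) : ℂ := (∑ n ∈ Finset.range N, u n) / N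

lemma norm_sum_shift_sub_le {u : ℕ → ℂ} (hu : ∀ n, ‖u n‖ ≤ 1) (h N : ℕ) :
    ‖∑ n ∈ Finset.range N, u (n + h) - ∑ n ∈ Finset.range N, u n‖ ≤ 2 * h := by
  induction h with
  | zero => simp
  | succ h ih =>
    have h1 : ∑ n ∈ Finset.range N, u (n + (h + 1)) - ∑ n ∈ Finset.range N, u (n + h)
        = u (N + h) - u h := by
      have := Finset.sum_range_sub (fun n => u (n + h)) N
      rw [zero_add] at this
      rw [← Finset.sum_sub_distrib, ← this]
      refine Finset.sum_congr rfl fun n _ => ?_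
      rw [add_right_comm, add_assoc]
    calc _ = ‖(u (N + h) - u h)
          + (∑ n ∈ Finset.range N, u (n + h) - ∑ n ∈ Finset.range N, u n)‖ := by
          rw [← h1]; congr 1; ring
      _ ≤ (1 + 1) + 2 * h := by
          refine (norm_add_le _ _).trans (add_le_add ?_ ih)
          exact (norm_sub_le _ _).trans (add_le_add (hu _) (hu _))
      _ = _ := by push_cast; ring

lemma tendsto_cesaroMean_shift {u : ℕ → ℂ} (hu : ∀ n, ‖u n‖ ≤ 1)
    (h0 : Tendsto (cesaroMean u) atTop (𝓝 0)) (h : ℕ) :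
    Tendsto (cesaroMean fun n => u (n + h)) atTop (𝓝 0) := by
  have h1 : Tendsto (fun N => cesaroMean (fun n => u (n + h)) N - cesaroMean u N)
      atTop (𝓝 0) := by
    refine squeeze_zero_norm (a := fun N : ℕ => (2 * h : ℝ) / N) (fun N => ?_)
      (tendsto_const_div_atTop_nhds_zero_nat _)
    rw [cesaroMean, cesaroMean, ← sub_div, norm_div, Complex.norm_natCast]
    gcongr
    exact norm_sum_shift_sub_le hu h N
  simpa using h1.add h0

/-- Qualitative van der Corput inequality: a bounded sequence has vanishing Cesàro means as soon as
all its nontrivial autocorrelations do. -/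
lemma tendsto_cesaroMean_of_correlations {u : ℕ → ℂ} (hu : ∀ n, ‖u n‖ ≤ 1)
    (hc : ∀ h : ℕ, 1 ≤ h →
      Tendsto (cesaroMean fun n => u (n + h) * star (u n)) atTop (𝓝 0)) :
    Tendsto (cesaroMean u) atTop (𝓝 0) := by
  have hc1 : ∀ h n, ‖u (n + h) * star (u n)‖ ≤ 1 := fun h n => by
    rw [norm_mul, norm_star]; exact mul_le_one₀ (hu _) (norm_nonneg _) (hu _)
  -- correlations of two distinct shifts of `u`
  have key1 : ∀ a b : ℕ, b < a →
      Tendsto (cesaroMean fun n => u (n + a) * star (u (n + b))) atTop (𝓝 0) := by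
    intro a b hab
    have := tendsto_cesaroMean_shift (hc1 (a - b)) (hc (a - b) (by omega)) b
    refine this.congr fun N => ?_
    simp only [cesaroMean]
    congr 1
    refine Finset.sum_congr rfl fun n _ => ?_
    rw [show n + b + (a - b) = n + a by omega]
  have key : ∀ a b : ℕ, a ≠ b →
      Tendsto (cesaroMean fun n => u (n + a) * star (u (n + b))) atTop (𝓝 0) := by
    intro a b hab
    rcases lt_or_gt_of_ne hab with h | h
    · have := (key1 b a h).star
      rw [star_zero] at this
      refine this.congr fun N => ?_
      simp [cesaroMean, mul_comm]
    · exact key1 a b h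
  rw [Metric.tendsto_atTop']
  intro ε hε
  -- averaging over `H` shifts gives the bound `√(2 / H)`, up to a vanishing error
  obtain ⟨H, hH⟩ := exists_nat_gt (8 / ε ^ 2)
  have hH0 : (0 : ℝ) < H := lt_trans (by positivity) hH
  have hH0' : H ≠ 0 := by rintro rfl; simp at hH0
  set w : ℕ → ℂ := fun n => ∑ h ∈ Finset.range H, u (n + h) with hw
  set R : ℕ → ℂ := fun N => ∑ p ∈ (Finset.range H ×ˢ Finset.range H).filter (fun p => p.1 ≠ p.2),
    cesaroMean (fun n => u (n + p.1) * star (u (n + p.2))) N with hR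
  have hRlim : Tendsto R atTop (𝓝 0) := by
    have := tendsto_finsetSum
      ((Finset.range H ×ˢ Finset.range H).filter (fun p => p.1 ≠ p.2))
      (fun p hp => key p.1 p.2 (Finset.mem_filter.1 hp).2)
    rwa [Finset.sum_const_zero] at this
  have hsq : ∀ N : ℕ, (∑ n ∈ Finset.range N, ‖w n‖ ^ 2) / N ≤ H + ‖R N‖ := by
    intro N
    have e1 : (((∑ n ∈ Finset.range N, ‖w n‖ ^ 2) / N : ℝ) : ℂ)
        = ∑ p ∈ Finset.range H ×ˢ Finset.range H,
          cesaroMean (fun n => u (n + p.1) * star (u (n + p.2))) N := by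
      simp only [cesaroMean]
      rw [← Finset.sum_div, Finset.sum_comm]
      push_cast
      congr 1
      refine Finset.sum_congr rfl fun n _ => ?_
      rw [← Complex.mul_conj', hw]
      simp only [map_sum]
      rw [Finset.sum_mul_sum, Finset.sum_product]
      rfl
    rw [← Finset.sum_filter_add_sum_filter_not _ (fun p : ℕ × ℕ => p.1 ≠ p.2)] at e1
    have e2 : ‖(((∑ n ∈ Finset.range N, ‖w n‖ ^ 2) / N : ℝ) : ℂ)‖ ≤ ‖R N‖ + H := by
      rw [e1]
      refine (norm_add_le _ _).trans (add_le_add le_rfl ?_)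
      refine (norm_sum_le _ _).trans ?_
      have hcard : ((Finset.range H ×ˢ Finset.range H).filter
          (fun p : ℕ × ℕ => ¬ p.1 ≠ p.2)).card = H := by
        have : (Finset.range H ×ˢ Finset.range H).filter (fun p : ℕ × ℕ => ¬ p.1 ≠ p.2)
            = (Finset.range H).diag := by
          ext ⟨a, b⟩; simp [Finset.mem_diag]; grind
        rw [this, Finset.diag_card, Finset.card_range]
      have hle : ∀ p ∈ (Finset.range H ×ˢ Finset.range H).filter (fun p : ℕ × ℕ => ¬ p.1 ≠ p.2),
          ‖cesaroMean (fun n => u (n + p.1) * star (u (n + p.2))) N‖ ≤ 1 := by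
        intro p _
        rw [cesaroMean, norm_div, Complex.norm_natCast]
        refine div_le_one_of_le₀ ((norm_sum_le _ _).trans ?_) (Nat.cast_nonneg _)
        calc _ ≤ ∑ n ∈ Finset.range N, (1 : ℝ) := Finset.sum_le_sum fun n _ => by
              rw [norm_mul, norm_star]; exact mul_le_one₀ (hu _) (norm_nonneg _) (hu _)
          _ = N := by simp
      calc _ ≤ _ := Finset.sum_le_sum hle
        _ = H := by rw [Finset.sum_const, hcard]; simp
    rw [Complex.norm_real, Real.norm_eq_abs] at e2
    linarith [le_abs_self ((∑ n ∈ Finset.range N, ‖w n‖ ^ 2) / (N : ℝ))]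
  have hdiff : ∀ N : ℕ, ‖H * ∑ n ∈ Finset.range N, u n - ∑ n ∈ Finset.range N, w n‖
      ≤ 2 * H * H := by
    intro N
    have : (H : ℂ) * ∑ n ∈ Finset.range N, u n - ∑ n ∈ Finset.range N, w n
        = ∑ h ∈ Finset.range H,
          -(∑ n ∈ Finset.range N, u (n + h) - ∑ n ∈ Finset.range N, u n) := by
      rw [hw, Finset.sum_comm, Finset.sum_neg_distrib, Finset.sum_sub_distrib]
      simp
    rw [this]
    refine (norm_sum_le _ _).trans ?_
    calc _ ≤ ∑ h ∈ Finset.range H, (2 * H : ℝ) := Finset.sum_le_sum fun h hh => by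
          rw [norm_neg]
          refine (norm_sum_shift_sub_le hu h N).trans ?_
          have : (h : ℝ) ≤ H := by exact_mod_cast (Finset.mem_range.1 hh).le
          linarith
      _ = _ := by simp; ring
  have hev : ∀ᶠ N in atTop, ‖R N‖ < H := by
    have := hRlim.norm
    rw [norm_zero] at this
    exact this.eventually (gt_mem_nhds hH0)
  have hev2 : ∀ᶠ N : ℕ in atTop, (2 * H : ℝ) / N < ε / 2 :=
    (tendsto_const_div_atTop_nhds_zero_nat (2 * H : ℝ)).eventually (gt_mem_nhds (by positivity))
  obtain ⟨N0, hN0⟩ := eventually_atTop.1 ((hev.and hev2).and (eventually_gt_atTop 0))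
  refine ⟨N0, fun N hN => ?_⟩
  obtain ⟨⟨h1, h2⟩, hNpos⟩ := hN0 N hN.le
  have hNr : (0 : ℝ) < N := by exact_mod_cast hNpos
  rw [dist_zero_right]
  have h3 : ‖∑ n ∈ Finset.range N, w n‖ ^ 2 ≤ N ^ 2 * (2 * H) := by
    calc _ ≤ (∑ n ∈ Finset.range N, ‖w n‖) ^ 2 := by gcongr; exact norm_sum_le _ _
      _ ≤ N * ∑ n ∈ Finset.range N, ‖w n‖ ^ 2 := by
          simpa using sq_sum_le_card_mul_sum_sq (s := Finset.range N) (f := fun n => ‖w n‖)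
      _ = N ^ 2 * ((∑ n ∈ Finset.range N, ‖w n‖ ^ 2) / N) := by field_simp
      _ ≤ N ^ 2 * (2 * H) := by
          gcongr; linarith [hsq N]
  have h4 : ‖∑ n ∈ Finset.range N, w n‖ < N * (H * (ε / 2)) := by
    refine lt_of_pow_lt_pow_left₀ 2 (by positivity) (h3.trans_lt ?_)
    rw [mul_pow]
    have : 8 < H * ε ^ 2 := by rwa [div_lt_iff₀ (by positivity)] at hH
    have : (2 * H : ℝ) < (H * (ε / 2)) ^ 2 := by nlinarith
    gcongr
  have h5 : H * ‖∑ n ∈ Finset.range N, u n‖ ≤ 2 * H * H + ‖∑ n ∈ Finset.range N, w n‖ := by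
    have := norm_le_norm_add_norm_sub' (H * ∑ n ∈ Finset.range N, u n) (∑ n ∈ Finset.range N, w n)
    rw [norm_mul, Complex.norm_natCast] at this
    linarith [hdiff N]
  rw [cesaroMean, norm_div, Complex.norm_natCast, div_lt_iff₀ hNr]
  rw [div_lt_iff₀ hNr] at h2
  have h6 : H * ‖∑ n ∈ Finset.range N, u n‖ < H * (ε * N) := by nlinarith
  exact lt_of_mul_lt_mul_left h6 hH0.le

/-! ### Weyl's theorem on exponential sums -/

lemma fourierChar_intCast (n : ℤ) : Real.fourierChar (n : ℝ) = 1 := by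
  ext
  rw [Real.fourierChar_apply]
  have := Complex.exp_int_mul_two_pi_mul_I n
  rw [Circle.coe_one, ← this]
  congr 1; push_cast; ring

lemma eq_intCast_of_fourierChar_eq_one {x : ℝ} (h : Real.fourierChar x = 1) :
    ∃ n : ℤ, x = n := by
  have h1 : ((Real.fourierChar x : Circle) : ℂ) = 1 := by rw [h]; rfl
  rw [Real.fourierChar_apply, Complex.exp_eq_one_iff] at h1
  obtain ⟨n, hn⟩ := h1
  refine ⟨n, ?_⟩
  have : ((x : ℂ)) * (2 * Real.pi * Complex.I) = n * (2 * Real.pi * Complex.I) := by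
    rw [← hn]; push_cast; ring
  exact_mod_cast mul_right_cancel₀ Complex.two_pi_I_ne_zero this

/-- The forward difference of a polynomial of degree at most `d + 1` has degree at most `d`, and its
coefficient of degree `d` is `(d + 1) h a`, where `a` is the coefficient of degree `d + 1`. -/
lemma coeff_taylor_sub_self {p : ℝ[X]} {d : ℕ} (hp : p.natDegree ≤ d + 1) (h : ℝ) :
    (taylor h p - p).natDegree ≤ d ∧
      (taylor h p - p).coeff d = (d + 1) * h * p.coeff (d + 1) := by
  constructor
  · rw [natDegree_le_iff_coeff_eq_zero]
    intro N hN
    rw [coeff_sub, taylor_coeff, eval_eq_sum_range' (n := 1)]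
    · simp [hasseDeriv_coeff]
    · refine Nat.lt_succ_of_le ?_
      refine (natDegree_hasseDeriv_le p N).trans ?_
      omega
  · rw [coeff_sub, taylor_coeff, eval_eq_sum_range' (n := 2)]
    · simp [hasseDeriv_coeff, Finset.sum_range_succ, add_comm 1 d]
      ring
    · refine Nat.lt_succ_of_le ?_
      refine (natDegree_hasseDeriv_le p d).trans ?_
      omega

/-- Weyl's theorem on exponential sums, by induction on the degree through van der Corput's
inequality: the correlations are exponential sums of forward differences. -/
theorem tendsto_cesaroMean_fourierChar_eval (d : ℕ) : ∀ p : ℝ[X], p.natDegree ≤ d + 1 →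
    Irrational (p.coeff (d + 1)) →
    Tendsto (cesaroMean fun n => (Real.fourierChar (p.eval (n : ℝ)) : ℂ)) atTop (𝓝 0) := by
  induction d with
  | zero =>
    intro p hp hirr
    set q : ℂ := (Real.fourierChar (p.coeff 1) : ℂ) with hq
    have hq1 : q ≠ 1 := by
      intro h
      obtain ⟨n, hn⟩ := eq_intCast_of_fourierChar_eq_one (x := p.coeff 1) (by ext; exact h)
      exact hirr.ne_int n hn
    have hval : ∀ n : ℕ, (Real.fourierChar (p.eval (n : ℝ)) : ℂ)
        = Real.fourierChar (p.coeff 0) * q ^ n := by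
      intro n
      rw [hq, ← Circle.coe_pow, ← AddChar.map_nsmul_eq_pow, ← Circle.coe_mul,
        ← AddChar.map_add_eq_mul, eval_eq_sum_range' (n := 2) (by omega)]
      simp [Finset.sum_range_succ, mul_comm]
    refine squeeze_zero_norm (a := fun N : ℕ => (2 / ‖q - 1‖ : ℝ) / N) (fun N => ?_)
      (tendsto_const_div_atTop_nhds_zero_nat _)
    rw [cesaroMean, norm_div, Complex.norm_natCast]
    gcongr
    simp_rw [hval]
    rw [← Finset.mul_sum, geom_sum_eq hq1, norm_mul, norm_div, Circle.norm_coe, one_mul]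
    gcongr
    refine (norm_sub_le _ _).trans ?_
    rw [norm_pow, hq, Circle.norm_coe]; norm_num
  | succ d ih =>
    intro p hp hirr
    refine tendsto_cesaroMean_of_correlations (fun n => (Circle.norm_coe _).le) fun h hh => ?_
    obtain ⟨h1, h2⟩ := coeff_taylor_sub_self hp (h : ℝ)
    refine (ih _ h1 ?_).congr fun N => ?_
    · rw [h2]
      have : Irrational (((((d + 1 : ℕ) : ℚ) + 1) * h : ℚ) * p.coeff (d + 1 + 1)) :=
        hirr.ratCast_mul (by positivity)
      simpa using this
    · simp only [cesaroMean]
      congr 1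
      refine Finset.sum_congr rfl fun n _ => ?_
      rw [eval_sub, AddChar.map_sub_eq_div, taylor_eval, Circle.coe_div, div_eq_mul_inv,
        ← Circle.coe_inv, Circle.coe_inv_eq_conj]
      push_cast
      rfl

/-- For suitable `Q`, along the positive multiples of `Q` the sequence `p n` modulo `1` is constant
when all nonconstant coefficients of `p` are rational, and its exponentials have vanishing Cesàro
means otherwise. -/
lemma exists_dilation_dichotomy (d : ℕ) : ∀ p : ℝ[X], p.natDegree ≤ d →
    ∃ Q : ℕ, 0 < Q ∧ ∀ Q' : ℕ, 0 < Q' → Q ∣ Q' →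
      ((∀ j, 1 ≤ j → ∃ q : ℚ, p.coeff j = q) ∧
        ∀ k : ℕ, Real.fourierChar (p.eval ((Q' * k : ℕ) : ℝ)) = Real.fourierChar (p.coeff 0)) ∨
      Tendsto (cesaroMean fun k => (Real.fourierChar (p.eval ((Q' * k : ℕ) : ℝ)) : ℂ))
        atTop (𝓝 0) := by
  induction d with
  | zero =>
    intro p hp
    refine ⟨1, one_pos, fun Q' _ _ => Or.inl ⟨fun j hj => ⟨0, ?_⟩, fun k => ?_⟩⟩
    · rw [coeff_eq_zero_of_natDegree_lt (by omega)]; simp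
    · rw [eval_eq_sum_range' (n := 1) (by omega)]; simp
  | succ d ih =>
    intro p hp
    by_cases hirr : Irrational (p.coeff (d + 1))
    · refine ⟨1, one_pos, fun Q' hQ' _ => Or.inr ?_⟩
      have h1 : (p.comp (C (Q' : ℝ) * X)).natDegree ≤ d + 1 := by
        refine natDegree_comp_le.trans ?_
        have : (C (Q' : ℝ) * X).natDegree ≤ 1 := (natDegree_C_mul_le _ _).trans natDegree_X_le
        nlinarith
      refine (tendsto_cesaroMean_fourierChar_eval d _ h1 ?_).congr fun N => ?_
      · rw [comp_C_mul_X_coeff]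
        have := hirr.mul_ratCast (q := (Q' : ℚ) ^ (d + 1)) (by positivity)
        simpa using this
      · simp [cesaroMean]
    · obtain ⟨r, hr⟩ : ∃ r : ℚ, (r : ℝ) = p.coeff (d + 1) := by
        simpa [Irrational] using hirr
      set p' : ℝ[X] := p - C (r : ℝ) * X ^ (d + 1) with hp'
      have hc : ∀ j, j ≠ d + 1 → p'.coeff j = p.coeff j := by
        intro j hj; rw [hp', coeff_sub, coeff_C_mul_X_pow, if_neg hj, sub_zero]
      have hdeg : p'.natDegree ≤ d := by
        rw [natDegree_le_iff_coeff_eq_zero]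
        intro N hN
        rcases eq_or_ne N (d + 1) with rfl | hne
        · rw [hp', coeff_sub, coeff_C_mul_X_pow, if_pos rfl, hr, sub_self]
        · rw [hc N hne]; exact coeff_eq_zero_of_natDegree_lt (by omega)
      obtain ⟨Q, hQ, hQ'⟩ := ih p' hdeg
      refine ⟨Q * r.den, Nat.mul_pos hQ r.pos, fun Q' hpos hdvd => ?_⟩
      have heq : ∀ k : ℕ, Real.fourierChar (p.eval ((Q' * k : ℕ) : ℝ))
          = Real.fourierChar (p'.eval ((Q' * k : ℕ) : ℝ)) := by
        intro k
        obtain ⟨t, rfl⟩ := (Dvd.intro_left _ rfl : r.den ∣ Q * r.den).trans hdvd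
        have : p.eval ((r.den * t * k : ℕ) : ℝ) = p'.eval ((r.den * t * k : ℕ) : ℝ)
            + ((r.num * (t * k) * (r.den * t * k) ^ d : ℤ) : ℝ) := by
          rw [hp', eval_sub]
          have hden : (r : ℝ) * r.den = r.num := by exact_mod_cast Rat.mul_den_eq_num r
          simp only [eval_mul, eval_C, eval_pow, eval_X]
          push_cast
          rw [← hden]; ring
        rw [this, AddChar.map_add_eq_mul, fourierChar_intCast, mul_one]
      rcases hQ' Q' hpos ((Dvd.intro _ rfl).trans hdvd) with ⟨h1, h2⟩ | h
      · refine Or.inl ⟨fun j hj => ?_, fun k => ?_⟩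
        · rcases eq_or_ne j (d + 1) with rfl | hne
          · exact ⟨r, hr.symm⟩
          · rw [← hc j hne]; exact h1 j hj
        · rw [heq, h2, hc 0 (by omega)]
      · right; simpa only [heq] using h

/-! ### Simultaneous polynomial approximation -/

lemma tendsto_cesaroMean_const (c : ℂ) : Tendsto (cesaroMean fun _ => c) atTop (𝓝 c) := by
  refine tendsto_const_nhds.congr' ?_
  filter_upwards [eventually_gt_atTop 0] with N hN
  have : (N : ℂ) ≠ 0 := by exact_mod_cast hN.ne'
  rw [cesaroMean, Finset.sum_const, Finset.card_range, nsmul_eq_mul, mul_div_cancel_left₀ _ this]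

/-- The Fejér-type kernel `((1 + cos 2πy) / 2) ^ M = (|1 + exp (2πiy)| ^ 2 / 4) ^ M` as a trigonometric
polynomial with nonnegative coefficients. -/
lemma kernel_expansion (M : ℕ) (y : ℝ) :
    (((‖1 + (Real.fourierChar y : ℂ)‖ ^ 2 / 4) ^ M : ℝ) : ℂ)
      = ∑ a ∈ Finset.range (2 * M + 1), (((2 * M).choose a / 4 ^ M : ℝ) : ℂ)
          * Real.fourierChar (((a : ℝ) - M) * y) := by
  have h1 : ((‖1 + (Real.fourierChar y : ℂ)‖ ^ 2 : ℝ) : ℂ)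
      = (Real.fourierChar y + 1) ^ 2 * Real.fourierChar (-y) := by
    have h2 : (Real.fourierChar y : ℂ) * Real.fourierChar (-y) = 1 := by
      rw [← Circle.coe_mul, ← AddChar.map_add_eq_mul]; simp
    have h3 : (starRingEnd ℂ) (Real.fourierChar y : ℂ) = Real.fourierChar (-y) := by
      rw [AddChar.map_neg_eq_inv, Circle.coe_inv_eq_conj]
    rw [Complex.ofReal_pow, ← Complex.mul_conj', map_add, map_one, h3]
    linear_combination (-1 - (Real.fourierChar y : ℂ)) * h2
  rw [Complex.ofReal_pow, Complex.ofReal_div, h1, div_pow, mul_pow, ← pow_mul, add_pow,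
    Finset.sum_mul, Finset.sum_div]
  refine Finset.sum_congr rfl fun a _ => ?_
  have : (Real.fourierChar (((a : ℝ) - M) * y) : ℂ)
      = (Real.fourierChar y : ℂ) ^ a * (Real.fourierChar (-y) : ℂ) ^ M := by
    rw [← Circle.coe_pow, ← Circle.coe_pow, ← AddChar.map_nsmul_eq_pow,
      ← AddChar.map_nsmul_eq_pow, ← Circle.coe_mul, ← AddChar.map_add_eq_mul]
    congr 2; simp only [nsmul_eq_mul]; ring
  rw [this]
  push_cast
  ring

/-- Simultaneous polynomial approximation. If `φ j`, for `j ≥ 1`, are `ℚ`-linear maps which vanish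
at `1`, then the numbers `n ^ j * x` approximate the numbers `φ j x` modulo `1`, simultaneously for
any finite family of pairs `(x, j)` with `j ≥ 1`. -/
theorem exists_fourierChar_pow_mul_close {ι : Type*} [Fintype ι]
    (x : ι → ℝ) (e : ι → ℕ)
    (he : ∀ i, 1 ≤ e i) (φ : ℕ → ℝ →ₗ[ℚ] ℝ) (hφ : ∀ j, 1 ≤ j → φ j 1 = 0) {δ : ℝ} (hδ : 0 < δ)
    (N : ℕ) :
    ∃ n ≥ N, ∀ i, dist (Real.fourierChar ((n : ℝ) ^ e i * x i))
      (Real.fourierChar (φ (e i) (x i))) < δ := by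
  classical
  by_contra! hcon
  set r := Fintype.card ι
  -- `g n i` is `1` when `n ^ e i * x i` equals its target modulo `1`, and is smaller otherwise
  set y : ℕ → ι → ℝ := fun n i => (n : ℝ) ^ e i * x i - φ (e i) (x i) with hy
  set g : ℕ → ι → ℝ := fun n i => ‖1 + (Real.fourierChar (y n i) : ℂ)‖ ^ 2 / 4 with hg
  have hg0 : ∀ n i, 0 ≤ g n i := fun n i => by positivity
  have hgd : ∀ n i, g n i = 1 - dist (Real.fourierChar ((n : ℝ) ^ e i * x i))
      (Real.fourierChar (φ (e i) (x i))) ^ 2 / 4 := by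
    intro n i
    set z : ℂ := (Real.fourierChar (y n i) : ℂ) with hz
    have hd : dist (Real.fourierChar ((n : ℝ) ^ e i * x i))
        (Real.fourierChar (φ (e i) (x i))) = ‖1 - z‖ := by
      have h1 : (Real.fourierChar ((n : ℝ) ^ e i * x i) : ℂ)
          = Real.fourierChar (φ (e i) (x i)) * z := by
        rw [hz, ← Circle.coe_mul, ← AddChar.map_add_eq_mul]; simp [hy]
      change dist (Real.fourierChar ((n : ℝ) ^ e i * x i) : ℂ) _ = _
      rw [dist_eq_norm, h1,
        show (Real.fourierChar (φ (e i) (x i)) : ℂ) * z - Real.fourierChar (φ (e i) (x i))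
          = -(Real.fourierChar (φ (e i) (x i)) * (1 - z)) by ring, norm_neg, norm_mul,
        Circle.norm_coe, one_mul]
    have hpar := parallelogram_law_with_norm ℝ (1 : ℂ) z
    rw [norm_one, hz, Circle.norm_coe, ← hz] at hpar
    rw [hd, hg]
    simp only
    rw [← hz]
    nlinarith
  have hg1 : ∀ n i, g n i ≤ 1 := fun n i => by rw [hgd]; linarith [sq_nonneg (dist
    (Real.fourierChar ((n : ℝ) ^ e i * x i)) (Real.fourierChar (φ (e i) (x i))))]
  set ρ : ℝ := 1 - δ ^ 2 / 4 with hρ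
  have hprod : ∀ n ≥ N, ∏ i, g n i ≤ ρ := by
    intro n hn
    obtain ⟨i, hi⟩ := hcon n hn
    rw [← Finset.mul_prod_erase _ _ (Finset.mem_univ i)]
    calc _ ≤ g n i * 1 := by
          refine mul_le_mul_of_nonneg_left ?_ (hg0 n i)
          exact Finset.prod_le_one (fun j _ => hg0 n j) (fun j _ => hg1 n j)
      _ ≤ ρ := by
          rw [mul_one, hgd]
          have : δ ^ 2 ≤ dist (Real.fourierChar ((n : ℝ) ^ e i * x i))
            (Real.fourierChar (φ (e i) (x i))) ^ 2 := by gcongr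
          linarith
  have hρ0 : 0 ≤ ρ := (Finset.prod_nonneg fun i _ => hg0 N i).trans (hprod N le_rfl)
  have hρ1 : ρ < 1 := by rw [hρ]; linarith [pow_pos hδ 2]
  -- lower bound for the mean of the kernel, coming from its constant term
  have main : ∀ M : ℕ, 0 < M → (1 / (2 * M : ℝ)) ^ r ≤ ρ ^ M := by
    intro M hM
    set I : Finset (ι → ℕ) := Fintype.piFinset fun _ => Finset.range (2 * M + 1) with hI
    set c : (ι → ℕ) → ℝ := fun m => ∏ i, ((2 * M).choose (m i) / 4 ^ M : ℝ) with hc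
    have hc0 : ∀ m, 0 ≤ c m := fun m => Finset.prod_nonneg fun i _ => by positivity
    set p : (ι → ℕ) → ℝ[X] := fun m => ∑ i, C (((m i : ℝ) - M) * x i) * X ^ e i with hp
    set t : (ι → ℕ) → ℝ := fun m => ∑ i, ((m i : ℝ) - M) * φ (e i) (x i) with ht
    have hpcoeff : ∀ m j, (p m).coeff j
        = ∑ i with e i = j, ((m i : ℝ) - M) * x i := by
      intro m j
      simp only [hp, finsetSum_coeff, coeff_C_mul_X_pow]
      rw [Finset.sum_filter]
      simp only [eq_comm]
    have hexp : ∀ n : ℕ, ((∏ i, g n i ^ M : ℝ) : ℂ)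
        = ∑ m ∈ I, (c m : ℂ) * (Real.fourierChar (-t m)
          * Real.fourierChar ((p m).eval (n : ℝ))) := by
      intro n
      rw [Complex.ofReal_prod]
      simp only [hg, kernel_expansion]
      rw [Finset.prod_univ_sum]
      refine Finset.sum_congr rfl fun m _ => ?_
      rw [Finset.prod_mul_distrib, hc, Complex.ofReal_prod]
      congr 1
      rw [← Circle.coe_mul, ← AddChar.map_add_eq_mul]
      have : -t m + (p m).eval (n : ℝ) = ∑ i, ((m i : ℝ) - M) * y n i := by
        simp only [ht, hp, hy, eval_finsetSum, eval_mul, eval_C, eval_pow, eval_X]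
        rw [← Finset.sum_neg_distrib, ← Finset.sum_add_distrib]
        exact Finset.sum_congr rfl fun i _ => by ring
      rw [this]
      have h2 : Real.fourierChar (∑ i, ((m i : ℝ) - M) * y n i)
          = ∏ i, Real.fourierChar (((m i : ℝ) - M) * y n i) :=
        map_prod Real.fourierChar.toMonoidHom
          (fun i => Multiplicative.ofAdd (((m i : ℝ) - M) * y n i)) _
      rw [h2]
      exact (map_prod Circle.coeHom
        (fun i => Real.fourierChar (((m i : ℝ) - M) * y n i)) Finset.univ).symm
    -- Along the multiples of `q` every term of the expansion has a mean: `1` or `0`. A term with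
    -- rational frequencies is constant, and its phase `t m` vanishes because the maps `φ j` kill `ℚ`.
    choose Q hQ hQ' using fun m => exists_dilation_dichotomy _ (p m) le_rfl
    set q : ℕ := ∏ m ∈ I, Q m with hq
    have hqpos : 0 < q := Finset.prod_pos fun m _ => hQ m
    have hlim : ∀ m ∈ I, ∃ l : ℝ, 0 ≤ l ∧ ((∀ i, m i = M) → l = 1) ∧
        Tendsto (cesaroMean fun k => (Real.fourierChar (-t m)
          * Real.fourierChar ((p m).eval ((q * k : ℕ) : ℝ)) : ℂ)) atTop (𝓝 (l : ℂ)) := by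
      intro m hm
      rcases hQ' m q hqpos (Finset.dvd_prod_of_mem Q hm) with ⟨h1, h2⟩ | h
      · refine ⟨1, zero_le_one, fun _ => rfl, ?_⟩
        have ht0 : t m = 0 := by
          have h3 : t m = ∑ j ∈ Finset.univ.image e, φ j ((p m).coeff j) := by
            rw [ht]
            simp only [hpcoeff, map_sum]
            rw [← Finset.sum_fiberwise_of_maps_to (s := Finset.univ)
              (t := Finset.univ.image e) (g := e)
              (fun i _ => Finset.mem_image_of_mem e (Finset.mem_univ i))]
            refine Finset.sum_congr rfl fun j _ => Finset.sum_congr rfl fun i hi => ?_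
            rw [(Finset.mem_filter.1 hi).2]
            have := (φ j).map_smul ((m i : ℚ) - M) (x i)
            simp only [Rat.smul_def] at this
            push_cast at this
            exact this.symm
          rw [h3]
          refine Finset.sum_eq_zero fun j hj => ?_
          obtain ⟨i, -, rfl⟩ := Finset.mem_image.1 hj
          obtain ⟨s, hs⟩ := h1 (e i) (he i)
          have := (φ (e i)).map_smul s 1
          rw [hφ _ (he i), smul_zero, Rat.smul_def, mul_one] at this
          rw [hs, this]
        have hp0 : (p m).coeff 0 = 0 := by
          rw [hpcoeff]
          refine Finset.sum_eq_zero fun i hi => ?_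
          have := he i
          rw [(Finset.mem_filter.1 hi).2] at this
          omega
        simp only [h2, ht0, hp0]
        simpa using tendsto_cesaroMean_const 1
      · refine ⟨0, le_rfl, fun hall => ?_, ?_⟩
        · exfalso
          have hp0 : p m = 0 := by simp [hp, hall]
          simp only [hp0, eval_zero, AddChar.map_zero_eq_one, Circle.coe_one] at h
          exact one_ne_zero (tendsto_nhds_unique (tendsto_cesaroMean_const 1) h)
        · have := h.const_mul (Real.fourierChar (-t m) : ℂ)
          simp only [mul_zero] at this
          refine this.congr fun X => ?_
          rw [cesaroMean, cesaroMean, ← mul_div_assoc, Finset.mul_sum]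
    choose! l hl0 hl1 hl using hlim
    have hK : Tendsto (cesaroMean fun k => ((∏ i, g (q * k) i ^ M : ℝ) : ℂ)) atTop
        (𝓝 ((∑ m ∈ I, c m * l m : ℝ) : ℂ)) := by
      have := tendsto_finsetSum I (fun m hm => (hl m hm).const_mul (c m : ℂ))
      rw [Complex.ofReal_sum]
      simp only [Complex.ofReal_mul]
      refine this.congr fun X => ?_
      simp only [cesaroMean]
      rw [Finset.sum_congr rfl (fun k _ => hexp (q * k)), Finset.sum_comm, Finset.sum_div]
      refine Finset.sum_congr rfl fun m _ => ?_
      rw [← mul_div_assoc, Finset.mul_sum]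
    have hρM : Tendsto (cesaroMean fun k => ((max (∏ i, g (q * k) i ^ M) (ρ ^ M) : ℝ) : ℂ))
        atTop (𝓝 ((ρ ^ M : ℝ) : ℂ)) := by
      have hev : (fun k => ((max (∏ i, g (q * k) i ^ M) (ρ ^ M) : ℝ) : ℂ))
          =ᶠ[atTop] fun _ => ((ρ ^ M : ℝ) : ℂ) := by
        filter_upwards [eventually_ge_atTop N] with k hk
        have hk' : q * k ≥ N := hk.trans (Nat.le_mul_of_pos_left k hqpos)
        rw [max_eq_right]
        rw [Finset.prod_pow]
        exact pow_le_pow_left₀ (Finset.prod_nonneg fun i _ => hg0 _ i) (hprod _ hk') M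
      have := (tendsto_const_nhds.congr' hev.symm).cesaro_smul
      refine this.congr fun X => ?_
      rw [cesaroMean, Complex.real_smul, div_eq_inv_mul]
      push_cast
      rfl
    have hle : ∑ m ∈ I, c m * l m ≤ ρ ^ M := by
      have h1 := (Complex.continuous_re.tendsto _).comp hK
      have h2 := (Complex.continuous_re.tendsto _).comp hρM
      rw [Complex.ofReal_re] at h1 h2
      refine le_of_tendsto_of_tendsto' h1 h2 fun X => ?_
      simp only [Function.comp, cesaroMean]
      rw [← Complex.ofReal_sum, ← Complex.ofReal_sum, ← Complex.ofReal_natCast,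
        ← Complex.ofReal_div, ← Complex.ofReal_div, Complex.ofReal_re, Complex.ofReal_re]
      gcongr
      exact le_max_left _ _
    refine le_trans ?_ hle
    have hmem : (fun _ => M) ∈ I := by
      rw [hI, Fintype.mem_piFinset]; intro i; rw [Finset.mem_range]; omega
    refine le_trans ?_ (Finset.single_le_sum (f := fun m => c m * l m)
      (fun m hm => mul_nonneg (hc0 m) (hl0 m hm)) hmem)
    rw [hl1 _ hmem (fun _ => rfl), mul_one, hc]
    simp only [Finset.prod_const, Finset.card_univ]
    refine pow_le_pow_left₀ (by positivity) ?_ _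
    rw [div_le_div_iff₀ (by positivity) (by positivity), one_mul]
    have := Nat.four_pow_le_two_mul_self_mul_centralBinom M hM
    rw [Nat.centralBinom] at this
    have h2 : (4 : ℝ) ^ M ≤ 2 * M * (2 * M).choose M := by exact_mod_cast this
    linarith
  -- exponential decay beats the polynomial lower bound
  have hlim0 := (tendsto_pow_const_mul_const_pow_of_lt_one r hρ0 hρ1).const_mul ((2 : ℝ) ^ r)
  rw [mul_zero] at hlim0
  obtain ⟨M, hM, hM0⟩ := ((hlim0.eventually (gt_mem_nhds one_pos)).and
    (eventually_gt_atTop 0)).exists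
  have h1 := main M hM0
  have hMr : (0 : ℝ) < M := by exact_mod_cast hM0
  rw [one_div, inv_pow, inv_le_iff_one_le_mul₀ (by positivity), mul_pow] at h1
  linarith

/-! ### Prescribed limits of multiplications by powers -/

/-- The coarsest filter finer than `atTop` along which `n ^ j * a` tends to `φ j a` modulo `1`, for
all real `a` and all `j`. -/
noncomputable def powerFilter (φ : ℕ → ℝ →ₗ[ℚ] ℝ) : Filter ℕ :=
  atTop ⊓ ⨅ a : ℝ, ⨅ j : ℕ, comap (fun n : ℕ => Real.fourierChar ((n : ℝ) ^ j * a))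
    (𝓝 (Real.fourierChar (φ j a)))

lemma powerFilter_le_atTop (φ : ℕ → ℝ →ₗ[ℚ] ℝ) : powerFilter φ ≤ atTop := inf_le_left

lemma tendsto_powerFilter (φ : ℕ → ℝ →ₗ[ℚ] ℝ) (j : ℕ) (a : ℝ) :
    Tendsto (fun n : ℕ => Real.fourierChar ((n : ℝ) ^ j * a)) (powerFilter φ)
      (𝓝 (Real.fourierChar (φ j a))) := by
  rw [tendsto_iff_comap]
  exact inf_le_right.trans ((iInf_le _ a).trans (iInf_le _ j))

/-- By simultaneous approximation, the multiplications by `n ^ j` modulo `1` can be made to converge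
to any prescribed `ℚ`-linear maps vanishing on `ℚ`, for all real arguments at once. -/
lemma powerFilter_neBot {φ : ℕ → ℝ →ₗ[ℚ] ℝ} (hφ0 : φ 0 = LinearMap.id)
    (hφ : ∀ j, 1 ≤ j → φ j 1 = 0) : (powerFilter φ).NeBot := by
  rw [powerFilter, iInf_prod', inf_neBot_iff]
  intro A hA B hB
  obtain ⟨N, hN⟩ := mem_atTop_sets.1 hA
  obtain ⟨I, hI, V, hV, rfl⟩ := mem_iInf.1 hB
  have hV' : ∀ i : I, ∃ δ > 0, ∀ n : ℕ, dist (Real.fourierChar ((n : ℝ) ^ i.1.2 * i.1.1))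
      (Real.fourierChar (φ i.1.2 i.1.1)) < δ → n ∈ V i := by
    intro i
    obtain ⟨t, ht, hsub⟩ := mem_comap.1 (hV i)
    obtain ⟨δ, hδ, hball⟩ := Metric.mem_nhds_iff.1 ht
    exact ⟨δ, hδ, fun n hn => hsub (hball hn)⟩
  choose δ hδ hδV using hV'
  have : Fintype I := hI.fintype
  obtain ⟨δ0, hδ0, hle⟩ : ∃ δ0 > 0, ∀ i, δ0 ≤ δ i := by
    rcases isEmpty_or_nonempty I with h | h
    · exact ⟨1, one_pos, fun i => (h.false i).elim⟩
    · obtain ⟨i, hi⟩ := Finite.exists_min δ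
      exact ⟨δ i, hδ i, hi⟩
  obtain ⟨n, hn, hclose⟩ := exists_fourierChar_pow_mul_close
    (ι := {i : I // 1 ≤ i.1.2}) (fun i => i.1.1.1) (fun i => i.1.1.2) (fun i => i.2) φ hφ hδ0 N
  refine ⟨n, hN n hn, Set.mem_iInter.2 fun i => hδV i n ?_⟩
  rcases Nat.eq_zero_or_pos i.1.2 with h0 | h0
  · rw [h0, hφ0]
    simpa using hδ i
  · exact (hclose ⟨i, h0⟩).trans_le (hle i)

/-! ### Filters of iterated limits -/

/-- The filter of iterated limits on lists of length `m`: a property holds eventually when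
`∀ᶠ n₁, ∀ᶠ n₂, …, ∀ᶠ nₘ`, it holds for `[n₁, …, nₘ]`. -/
def listFilter (f : Filter ℕ) : ℕ → Filter (List ℕ)
  | 0 => pure []
  | m + 1 => f.bind fun n => (listFilter f m).map (List.cons n)

lemma eventually_listFilter_succ {f : Filter ℕ} {m : ℕ} {P : List ℕ → Prop} :
    (∀ᶠ l in listFilter f (m + 1), P l) ↔ ∀ᶠ n in f, ∀ᶠ l in listFilter f m, P (n :: l) := by
  rw [listFilter, eventually_bind]
  simp only [eventually_map]

lemma eventually_listFilter_add {f : Filter ℕ} {m m' : ℕ} : ∀ {P : List ℕ → Prop},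
    (∀ᶠ l in listFilter f (m + m'), P l) ↔
      ∀ᶠ s in listFilter f m, ∀ᶠ t in listFilter f m', P (s ++ t) := by
  induction m with
  | zero => intro P; simp [listFilter]
  | succ m ih =>
    intro P
    rw [Nat.succ_add, eventually_listFilter_succ, eventually_listFilter_succ]
    simp only [ih, List.cons_append]

lemma eventually_length_listFilter (f : Filter ℕ) (m : ℕ) :
    ∀ᶠ l in listFilter f m, l.length = m := by
  induction m with
  | zero => simp [listFilter]
  | succ m ih =>
    rw [eventually_listFilter_succ]
    refine Eventually.of_forall fun n => ih.mono fun l hl => by simp [hl]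

/-- A property which holds eventually along the iterated limits holds for all increasing subfamilies
of a suitable increasing sequence. -/
theorem exists_strictMono_of_eventually_listFilter {f : Filter ℕ} [f.NeBot] (hf : f ≤ atTop)
    (m : ℕ) {P : List ℕ → Prop} (hP : ∀ᶠ l in listFilter f m, P l) :
    ∃ n : ℕ → ℕ, StrictMono n ∧ (∀ i, 0 < n i) ∧
      ∀ k : Fin m → ℕ, StrictMono k → P (List.ofFn fun i => n (k i)) := by
  classical
  -- `Q l`: the list `l` is a good beginning of a list of length `m`
  set Q : List ℕ → Prop := fun l =>
    l.length ≤ m → ∀ᶠ t in listFilter f (m - l.length), P (l ++ t) with hQ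
  have hQ0 : Q [] := fun _ => by simpa using hP
  have hQs : ∀ l, Q l → ∀ᶠ n in f, Q (l ++ [n]) := by
    intro l hl
    rcases Nat.lt_or_ge l.length m with h | h
    · have h1 := hl h.le
      rw [show m - l.length = (m - (l.length + 1)) + 1 by omega, eventually_listFilter_succ] at h1
      refine h1.mono fun n hn _ => ?_
      simpa using hn
    · refine Eventually.of_forall fun n hn => ?_
      simp at hn; omega
  have hstep : ∀ H : {H : List ℕ // ∀ l, l.Sublist H → Q l}, ∃ n : ℕ,
      (0 < n ∧ ∀ a ∈ H.1, a < n) ∧ ∀ l, l.Sublist (H.1 ++ [n]) → Q l := by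
    intro H
    have h1 : ∀ᶠ n in f, ∀ l ∈ H.1.sublists.toFinset, Q (l ++ [n]) := by
      rw [Filter.eventually_all_finset]
      intro l hl
      exact hQs l (H.2 l (by simpa using hl))
    have h2 : ∀ᶠ n in f, ∀ a ∈ H.1.toFinset, a < n := by
      rw [Filter.eventually_all_finset]
      exact fun a _ => hf (eventually_gt_atTop a)
    obtain ⟨n, ⟨h1, h2⟩, h3⟩ := ((h1.and h2).and (hf (eventually_gt_atTop 0))).exists
    refine ⟨n, ⟨h3, fun a ha => h2 a (by simpa using ha)⟩, fun l hl => ?_⟩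
    obtain ⟨l1, l2, rfl, hl1, hl2⟩ := List.sublist_append_iff.1 hl
    rcases List.sublist_cons_iff.1 hl2 with h | ⟨r, rfl, hr⟩
    · rw [List.sublist_nil.1 h, List.append_nil]; exact H.2 _ hl1
    · rw [List.sublist_nil.1 hr]; exact h1 l1 (by simpa using hl1)
  choose next hnext hgood using hstep
  -- the list of the terms chosen so far, all of whose sublists are good beginnings
  let hist : ℕ → {H : List ℕ // ∀ l, l.Sublist H → Q l} := fun N =>
    Nat.rec ⟨[], fun l hl => by rw [List.sublist_nil.1 hl]; exact hQ0⟩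
      (fun _ H => ⟨H.1 ++ [next H], hgood H⟩) N
  have hhist : ∀ N, (hist N).1 = (List.range N).map fun i => next (hist i) := by
    intro N
    induction N with
    | zero => rfl
    | succ N ih =>
      rw [List.range_succ, List.map_append, ← ih]; rfl
  refine ⟨fun N => next (hist N), strictMono_nat_of_lt_succ fun N => ?_,
    fun N => (hnext (hist N)).1, fun k hk => ?_⟩
  · refine (hnext (hist (N + 1))).2 _ ?_
    have h1 : next (hist N) ∈ (List.range (N + 1)).map fun i => next (hist i) :=
      List.mem_map.2 ⟨N, by simp, rfl⟩
    rwa [← hhist] at h1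
  · obtain ⟨N, hN⟩ : ∃ N, ∀ i, k i < N :=
      ⟨Finset.univ.sup k + 1, fun i => Nat.lt_succ_of_le (Finset.le_sup (Finset.mem_univ i))⟩
    have hfil : (List.range N).filter (fun a => a ∈ List.ofFn k) = List.ofFn k := by
      refine List.Perm.eq_of_pairwise' (r := (· < ·)) ?_ ?_ ?_
      · exact List.Pairwise.filter _ List.pairwise_lt_range
      · exact List.pairwise_ofFn.2 fun i j h => hk h
      · rw [List.perm_ext_iff_of_nodup (List.nodup_range.filter _) (List.nodup_ofFn.2 hk.injective)]
        intro a
        simp only [List.mem_filter, List.mem_range, decide_eq_true_eq, and_iff_right_iff_imp,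
          List.mem_ofFn']
        rintro ⟨i, rfl⟩
        exact hN i
    have hsub : (List.ofFn fun i => next (hist (k i))).Sublist (hist N).1 := by
      rw [hhist]
      have := (List.filter_sublist (l := List.range N) (p := fun a => a ∈ List.ofFn k)).map
        (fun i => next (hist i))
      rw [hfil, List.map_ofFn] at this
      exact this
    have := (hist N).2 _ hsub
    simpa [hQ, listFilter] using this

/-! ### Iterated limits of iterated differences -/

/-- `iterDiff ℓ` of the first `2 ^ ℓ` entries of a list. -/
def listDiff (ℓ : ℕ) (l : List ℕ) : ℤ := iterDiff ℓ fun i => ((l.getD i 0 : ℕ) : ℤ)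

lemma listDiff_append {ℓ : ℕ} {s t : List ℕ} (hs : s.length = 2 ^ ℓ) :
    listDiff (ℓ + 1) (s ++ t) = listDiff ℓ t - listDiff ℓ s := by
  rw [listDiff, iterDiff, listDiff, listDiff]
  congr 1
  · congr 1; ext i
    simp [List.getD_eq_getElem?_getD, List.getElem?_append_right, hs]
  · congr 1; ext i
    simp [List.getD_eq_getElem?_getD, List.getElem?_append_left, hs]

lemma eventually_listDiff_succ {f : Filter ℕ} {ℓ : ℕ} {P : ℤ → Prop} :
    (∀ᶠ l in listFilter f (2 ^ (ℓ + 1)), P (listDiff (ℓ + 1) l)) ↔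
      ∀ᶠ s in listFilter f (2 ^ ℓ), ∀ᶠ t in listFilter f (2 ^ ℓ),
        P (listDiff ℓ t - listDiff ℓ s) := by
  rw [pow_succ, mul_two, eventually_listFilter_add]
  refine eventually_congr ((eventually_length_listFilter f _).mono fun s hs => ?_)
  simp only [listDiff_append hs]

/-- The multiplier which the `j`-th power of the iterated difference of order `ℓ` has in the limit
if `n ^ j` has the limit multiplier `φ j`. The recursion is the binomial expansion of `(y - x) ^ j`,
with `x` and `y` the iterated differences of the first and of the second half. As the limit in `y`
is taken first, the multiplier of the power of `y` is the inner factor of the product. -/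
def diffLimit {A : Type*} [Ring A] [Algebra ℚ A] (φ : ℕ → A) : ℕ → ℕ → A
  | 0, j => φ j
  | ℓ + 1, j => ∑ i ∈ Finset.range (j + 1),
      ((-1) ^ i * (j.choose i : ℚ)) • (diffLimit φ ℓ i * diffLimit φ ℓ (j - i))

/-- Limits modulo `1` are compatible with integer linear combinations. -/
lemma tendsto_fourierChar_sum {X : Type*} {F : Filter X} (s : Finset ℕ) (c : ℕ → ℤ)
    {g : ℕ → X → ℝ} {b : ℕ → ℝ}
    (h : ∀ i ∈ s, Tendsto (fun x => Real.fourierChar (g i x)) F (𝓝 (Real.fourierChar (b i)))) :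
    Tendsto (fun x => Real.fourierChar (∑ i ∈ s, (c i : ℝ) * g i x)) F
      (𝓝 (Real.fourierChar (∑ i ∈ s, (c i : ℝ) * b i))) := by
  have key : ∀ y : ℕ → ℝ, Real.fourierChar (∑ i ∈ s, (c i : ℝ) * y i)
      = ∏ i ∈ s, Real.fourierChar (y i) ^ c i := by
    intro y
    have h1 : Real.fourierChar (∑ i ∈ s, (c i : ℝ) * y i)
        = ∏ i ∈ s, Real.fourierChar ((c i : ℝ) * y i) :=
      map_prod Real.fourierChar.toMonoidHom
        (fun i => Multiplicative.ofAdd ((c i : ℝ) * y i)) _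
    rw [h1]
    refine Finset.prod_congr rfl fun i _ => ?_
    rw [← zsmul_eq_mul, AddChar.map_zsmul_eq_zpow]
  simp only [key]
  exact tendsto_finsetProd s fun i hi => (h i hi).zpow (c i)

/-- The iterated limit of `x ^ j * a` modulo `1`, for `x` the iterated difference of order `ℓ`, is
`diffLimit φ ℓ j a`. -/
theorem tendsto_fourierChar_listDiff {φ : ℕ → Module.End ℚ ℝ} {f : Filter ℕ}
    (hφ : ∀ j a, Tendsto (fun n : ℕ => Real.fourierChar ((n : ℝ) ^ j * a)) f
      (𝓝 (Real.fourierChar (φ j a)))) (ℓ : ℕ) : ∀ j a,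
    Tendsto (fun l => Real.fourierChar ((listDiff ℓ l : ℝ) ^ j * a)) (listFilter f (2 ^ ℓ))
      (𝓝 (Real.fourierChar (diffLimit φ ℓ j a))) := by
  induction ℓ with
  | zero =>
    intro j a
    rw [tendsto_nhds]
    intro U hU hmem
    have := (tendsto_nhds.1 (hφ j a)) U hU hmem
    change ∀ᶠ l in listFilter f 1, _
    rw [eventually_listFilter_succ]
    filter_upwards [this] with n hn
    simpa [listFilter, listDiff, iterDiff] using hn
  | succ ℓ ih =>
    intro j a
    rw [tendsto_nhds]
    intro U hU hmem
    refine (eventually_listDiff_succ (P := fun z => Real.fourierChar ((z : ℝ) ^ j * a) ∈ U)).2 ?_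
    -- the limit in the second half of the variables, with the first half fixed
    have hinner : ∀ x : ℤ, Tendsto
        (fun t => Real.fourierChar (((listDiff ℓ t - x : ℤ) : ℝ) ^ j * a))
        (listFilter f (2 ^ ℓ)) (𝓝 (Real.fourierChar (∑ i ∈ Finset.range (j + 1),
          (((-1) ^ i * j.choose i * x ^ i : ℤ) : ℝ) * diffLimit φ ℓ (j - i) a))) := by
      intro x
      refine (tendsto_fourierChar_sum _ (fun i => (-1) ^ i * j.choose i * x ^ i)
        (fun i _ => ih (j - i) a)).congr fun t => ?_
      congr 1
      rw [sub_eq_neg_add]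
      push_cast
      rw [add_pow, Finset.sum_mul]
      refine Finset.sum_congr rfl fun i _ => ?_
      rw [neg_pow (x : ℝ)]; ring
    -- then the limit in the first half
    have houter : Tendsto (fun s => Real.fourierChar (∑ i ∈ Finset.range (j + 1),
          (((-1) ^ i * j.choose i * listDiff ℓ s ^ i : ℤ) : ℝ) * diffLimit φ ℓ (j - i) a))
        (listFilter f (2 ^ ℓ)) (𝓝 (Real.fourierChar (diffLimit φ (ℓ + 1) j a))) := by
      have h1 : diffLimit φ (ℓ + 1) j a = ∑ i ∈ Finset.range (j + 1),
          (((-1) ^ i * j.choose i : ℤ) : ℝ) * diffLimit φ ℓ i (diffLimit φ ℓ (j - i) a) := by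
        rw [diffLimit, LinearMap.sum_apply]
        refine Finset.sum_congr rfl fun i _ => ?_
        rw [LinearMap.smul_apply, Module.End.mul_apply, Rat.smul_def]
        push_cast; rfl
      rw [h1]
      refine (tendsto_fourierChar_sum _ (fun i => (-1) ^ i * j.choose i)
        (fun i _ => ih i (diffLimit φ ℓ (j - i) a))).congr fun s => ?_
      congr 1
      refine Finset.sum_congr rfl fun i _ => ?_
      push_cast; ring
    exact (houter.eventually (hU.mem_nhds hmem)).mono fun s hs =>
      tendsto_nhds.1 (hinner (listDiff ℓ s)) U hU hs

/-! ### The words surviving in the limit -/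

lemma sum_range_two_mul {M : Type*} [AddCommMonoid M] (g : ℕ → M) (n : ℕ) :
    ∑ t ∈ Finset.range (2 * n), g t
      = ∑ s ∈ Finset.range n, g (2 * s) + ∑ s ∈ Finset.range n, g (2 * s + 1) := by
  induction n with
  | zero => simp
  | succ n ih =>
    rw [show 2 * (n + 1) = 2 * n + 1 + 1 by ring, Finset.sum_range_succ, Finset.sum_range_succ, ih,
      Finset.sum_range_succ, Finset.sum_range_succ]
    abel

/-- The limits `diffLimit φ ℓ j` when only `φ 0 = 1`, `φ 2 = E` and `φ (2 * b + 1) = O` are nonzero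
and `O * E = O * O = 0`. The only words in `E` and `O` which survive are `E ^ i` and `E ^ i * O`;
all coefficients are nonnegative, and that of `E ^ ℓ * O` is positive. -/
theorem exists_diffLimit_coeff {A : Type*} [Ring A] [Algebra ℚ A] {φ : ℕ → A} {E O : A} {b : ℕ}
    (h0 : φ 0 = 1) (h2 : φ 2 = E) (hb : φ (2 * b + 1) = O)
    (hφ : ∀ j, j ≠ 0 → j ≠ 2 → j ≠ 2 * b + 1 → φ j = 0) (hOE : O * E = 0) (hOO : O * O = 0)
    (ℓ : ℕ) : ∃ e o : ℕ → ℚ, (∀ i, 0 ≤ e i) ∧ (∀ i, 0 ≤ o i) ∧ e 0 = 1 ∧ 0 < e 1 ∧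
      (∀ h < b, o h = 0) ∧ 0 < o (b + ℓ) ∧ (∀ i, diffLimit φ ℓ (2 * i) = e i • E ^ i) ∧
      ∀ h, diffLimit φ ℓ (2 * h + 1) = o h • (E ^ (h - b) * O) := by
  have hOE' : ∀ (i : ℕ), 0 < i → ∀ x : A, x * O * E ^ i = 0 := by
    intro i hi x
    obtain ⟨i, rfl⟩ := Nat.exists_eq_succ_of_ne_zero hi.ne'
    rw [pow_succ', mul_assoc, ← mul_assoc O, hOE, zero_mul, mul_zero]
  have hOO' : ∀ (i : ℕ) (x : A), x * O * (E ^ i * O) = 0 := by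
    intro i x
    rcases Nat.eq_zero_or_pos i with rfl | hi
    · rw [pow_zero, one_mul, mul_assoc, hOO, mul_zero]
    · rw [← mul_assoc, hOE' i hi, zero_mul]
  induction ℓ with
  | zero =>
    refine ⟨fun i => if i ≤ 1 then 1 else 0, fun h => if h = b then 1 else 0,
      fun i => by positivity, fun i => by positivity, by simp, by simp,
      fun h hh => if_neg hh.ne, by simp, fun i => ?_, fun h => ?_⟩
    · rw [diffLimit]
      rcases i with _ | _ | i
      · simp [h0]
      · simp [h2]
      · rw [hφ _ (by omega) (by omega) (by omega)]; simp
    · rw [diffLimit]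
      by_cases hh : h = b
      · subst hh; simp [hb]
      · rw [hφ _ (by omega) (by omega) (by omega)]; simp [hh]
  | succ ℓ ih =>
    obtain ⟨e, o, he, ho, he0, he1, hob, hopos, hE, hO⟩ := ih
    refine ⟨fun i => ∑ s ∈ Finset.range (i + 1), ((2 * i).choose (2 * s) : ℚ) * (e s * e (i - s)),
      fun h => ∑ s ∈ Finset.range h,
        ((2 * h + 1).choose (2 * (s + 1)) : ℚ) * (e (s + 1) * o (h - (s + 1))),
      fun i => Finset.sum_nonneg fun s _ => mul_nonneg (Nat.cast_nonneg _)
        (mul_nonneg (he _) (he _)),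
      fun i => Finset.sum_nonneg fun s _ => mul_nonneg (Nat.cast_nonneg _)
        (mul_nonneg (he _) (ho _)), by simp [he0], ?_, ?_, ?_, ?_, ?_⟩
    · simp [Finset.sum_range_succ, he0]; linarith
    · intro h hh
      refine Finset.sum_eq_zero fun s _ => ?_
      rw [hob _ (by omega)]; ring
    · refine Finset.sum_pos' (fun s _ => mul_nonneg (Nat.cast_nonneg _)
        (mul_nonneg (he _) (ho _))) ⟨0, by simp, ?_⟩
      refine mul_pos ?_ (mul_pos he1 hopos)
      exact_mod_cast Nat.choose_pos (by omega)
    · intro i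
      have heven : ∀ s ∈ Finset.range (i + 1),
          ((-1) ^ (2 * s) * ((2 * i).choose (2 * s) : ℚ)) •
            (diffLimit φ ℓ (2 * s) * diffLimit φ ℓ (2 * i - 2 * s))
          = (((2 * i).choose (2 * s) : ℚ) * (e s * e (i - s))) • E ^ i := by
        intro s hs
        have hs' : s + (i - s) = i := by have := Finset.mem_range.1 hs; omega
        rw [← Nat.mul_sub, hE, hE, smul_mul_smul_comm, ← pow_add, hs', smul_smul, pow_mul,
          neg_one_sq, one_pow, one_mul]
      have hodd : ∀ s ∈ Finset.range i,
          ((-1) ^ (2 * s + 1) * ((2 * i).choose (2 * s + 1) : ℚ)) •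
            (diffLimit φ ℓ (2 * s + 1) * diffLimit φ ℓ (2 * i - (2 * s + 1))) = 0 := by
        intro s hs
        have := Finset.mem_range.1 hs
        rw [show 2 * i - (2 * s + 1) = 2 * (i - s - 1) + 1 by omega, hO, hO, smul_mul_smul_comm,
          hOO', smul_zero, smul_zero]
      rw [diffLimit, Finset.sum_range_succ, sum_range_two_mul, Finset.sum_eq_zero hodd, add_zero,
        ← Finset.sum_range_succ (fun s => ((-1) ^ (2 * s) * ((2 * i).choose (2 * s) : ℚ)) •
            (diffLimit φ ℓ (2 * s) * diffLimit φ ℓ (2 * i - 2 * s))),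
        Finset.sum_congr rfl heven, Finset.sum_smul]
    · intro h
      -- the two terms containing `diffLimit φ ℓ 0 = 1` cancel
      have hzero : diffLimit φ ℓ 0 = 1 := by simpa [he0] using hE 0
      have heven : ∀ s ∈ Finset.range h,
          ((-1) ^ (2 * (s + 1)) * ((2 * h + 1).choose (2 * (s + 1)) : ℚ)) •
            (diffLimit φ ℓ (2 * (s + 1)) * diffLimit φ ℓ (2 * h + 1 - 2 * (s + 1)))
          = (((2 * h + 1).choose (2 * (s + 1)) : ℚ) * (e (s + 1) * o (h - (s + 1)))) •
            (E ^ (h - b) * O) := by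
        intro s hs
        have hs' := Finset.mem_range.1 hs
        rw [show 2 * h + 1 - 2 * (s + 1) = 2 * (h - (s + 1)) + 1 by omega, hE, hO,
          smul_mul_smul_comm, ← mul_assoc, ← pow_add, smul_smul, pow_mul, neg_one_sq, one_pow,
          one_mul]
        rcases Nat.lt_or_ge (h - (s + 1)) b with hlt | hge
        · rw [hob _ hlt]; simp
        · rw [show s + 1 + (h - (s + 1) - b) = h - b by omega]
      have hodd : ∀ s ∈ Finset.range h,
          ((-1) ^ (2 * s + 1) * ((2 * h + 1).choose (2 * s + 1) : ℚ)) •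
            (diffLimit φ ℓ (2 * s + 1) * diffLimit φ ℓ (2 * h + 1 - (2 * s + 1))) = 0 := by
        intro s hs
        have := Finset.mem_range.1 hs
        rw [show 2 * h + 1 - (2 * s + 1) = 2 * (h - s) by omega, hO, hE, smul_mul_smul_comm,
          hOE' _ (by omega), smul_zero, smul_zero]
      rw [diffLimit, show 2 * h + 1 + 1 = 2 * (h + 1) by ring, sum_range_two_mul,
        Finset.sum_range_succ', Finset.sum_congr rfl heven, Finset.sum_range_succ,
        Finset.sum_eq_zero hodd, Finset.sum_smul]
      simp [hzero, pow_succ, pow_mul]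

/-! ### The choice of the limit maps -/

/-- The maps are defined on a Hamel basis `B` of `ℝ` over `ℚ` containing `1` and `α`. With distinct
further basis vectors `β 0, β 1, …`, the map `E` is the shift `β (n + 1) ↦ β n`, the map `O` sends
`α` to `β ℓ`, both kill the other basis vectors, and `lam` is the coordinate at `β 0`. -/
lemma exists_shift {α : ℝ} (hα : Irrational α) (ℓ : ℕ) :
    ∃ (E O : Module.End ℚ ℝ) (lam : ℝ →ₗ[ℚ] ℚ), E 1 = 0 ∧ O 1 = 0 ∧ lam 1 = 0 ∧
      O * E = 0 ∧ O * O = 0 ∧ (∀ i < ℓ, ∀ x, lam ((E ^ i) (O x)) = 0) ∧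
      lam ((E ^ ℓ) (O α)) = 1 := by
  classical
  have h1α : (1 : ℝ) ≠ α := fun h => hα.ne_one h.symm
  have hli : LinearIndepOn ℚ id ({1, α} : Set ℝ) := by
    rw [LinearIndepOn.pair_iff _ h1α]
    intro s t hst
    simp only [id, Rat.smul_def, mul_one] at hst
    have ht : t = 0 := by
      by_contra ht
      have ht' : (t : ℝ) ≠ 0 := by exact_mod_cast ht
      refine hα ⟨-s / t, ?_⟩
      push_cast
      rw [div_eq_iff ht']
      linarith
    subst ht
    simpa using hst
  have hsub := hli.subset_extend (Set.subset_univ _)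
  set S := hli.extend (Set.subset_univ _)
  set B : Module.Basis S ℚ ℝ := Module.Basis.extend hli with hB
  have hinf : Infinite S := by
    by_contra hfin
    rw [not_infinite_iff_finite] at hfin
    have h1 := B.mk_eq_rank
    rw [Real.rank_rat_real] at h1
    have h2 : Cardinal.mk S < Cardinal.aleph0 := Cardinal.lt_aleph0_of_finite S
    simp only [Cardinal.lift_id] at h1
    rw [h1] at h2
    exact absurd h2 (not_lt.2 Cardinal.aleph0_le_continuum)
  set i1 : S := ⟨1, hsub (by simp)⟩
  set iα : S := ⟨α, hsub (by simp)⟩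
  have hB1 : B i1 = 1 := by rw [hB, Module.Basis.extend_apply_self]
  have hBα : B iα = α := by rw [hB, Module.Basis.extend_apply_self]
  have hinf' : (({i1, iα} : Set S)ᶜ).Infinite := (Set.toFinite _).infinite_compl
  set β' := hinf'.natEmbedding
  set β : ℕ → S := fun n => (β' n).1 with hβ
  have hβinj : Function.Injective β := Subtype.val_injective.comp β'.injective
  have hβ1 : ∀ n, β n ≠ i1 := fun n h => (β' n).2 (by simp [← h, hβ])
  have hβα : ∀ n, β n ≠ iα := fun n h => (β' n).2 (by simp [← h, hβ])
  have h1ne : i1 ≠ iα := fun h => h1α (congrArg Subtype.val h)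
  set E : Module.End ℚ ℝ := B.constr ℚ
    (Function.extend β (fun n => if n = 0 then 0 else B (β (n - 1))) 0) with hE
  set O : Module.End ℚ ℝ := B.constr ℚ (fun i => if i = iα then B (β ℓ) else 0) with hO
  have hEβ : ∀ n, E (B (β n)) = if n = 0 then 0 else B (β (n - 1)) := fun n => by
    rw [hE, Module.Basis.constr_basis, hβinj.extend_apply]
  have hEother : ∀ i, (∀ n, β n ≠ i) → E (B i) = 0 := fun i hi => by
    rw [hE, Module.Basis.constr_basis, Function.extend_apply' _ _ _ (by simpa using hi)]; rfl
  have hOB : ∀ i, O (B i) = if i = iα then B (β ℓ) else 0 := fun i => by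
    rw [hO, Module.Basis.constr_basis]
  have hOx : ∀ x, ∃ q : ℚ, O x = q • B (β ℓ) := by
    intro x
    refine ⟨B.repr x iα, ?_⟩
    have : O = (B.coord iα).smulRight (B (β ℓ)) := by
      refine B.ext fun i => ?_
      rw [hOB, LinearMap.smulRight_apply, Module.Basis.coord_apply, Module.Basis.repr_self]
      by_cases h : i = iα
      · simp [h]
      · rw [if_neg h, Finsupp.single_eq_of_ne (Ne.symm h), zero_smul]
    conv_lhs => rw [this]
    rfl
  have hEpow : ∀ i ≤ ℓ, (E ^ i) (B (β ℓ)) = B (β (ℓ - i)) := by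
    intro i
    induction i with
    | zero => intro _; simp
    | succ i ih =>
      intro hi
      rw [pow_succ', Module.End.mul_apply, ih (by omega), hEβ, if_neg (by omega)]
      rfl
  refine ⟨E, O, B.coord (β 0), ?_, ?_, ?_, ?_, ?_, ?_, ?_⟩
  · rw [← hB1]; exact hEother _ hβ1
  · rw [← hB1, hOB, if_neg h1ne]
  · rw [← hB1, Module.Basis.coord_apply, Module.Basis.repr_self,
      Finsupp.single_eq_of_ne (hβ1 0)]
  · refine B.ext fun i => ?_
    rw [Module.End.mul_apply]
    by_cases hi : ∃ n, β n = i
    · obtain ⟨n, rfl⟩ := hi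
      rw [hEβ]
      split_ifs
      · simp
      · rw [hOB, if_neg (hβα _)]; rfl
    · rw [hEother i (by simpa using hi)]; simp
  · refine LinearMap.ext fun x => ?_
    obtain ⟨q, hq⟩ := hOx x
    rw [Module.End.mul_apply, hq, map_smul, hOB, if_neg (hβα _), smul_zero]; rfl
  · intro i hi x
    obtain ⟨q, hq⟩ := hOx x
    rw [hq, map_smul, hEpow i hi.le, map_smul, Module.Basis.coord_apply, Module.Basis.repr_self,
      Finsupp.single_eq_of_ne (fun h => by have := hβinj h; omega), smul_zero]
  · rw [← hBα, hOB, if_pos rfl, hEpow ℓ le_rfl, Nat.sub_self, Module.Basis.coord_apply,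
      Module.Basis.repr_self, Finsupp.single_eq_same]

lemma IsOddPolynomial.coeff_two_mul {v : ℝ[X]} (hv : IsOddPolynomial v) (i : ℕ) :
    v.coeff (2 * i) = 0 := by
  obtain ⟨m, a, rfl⟩ := hv
  rw [finsetSum_coeff]
  refine Finset.sum_eq_zero fun j hj => ?_
  have := (Finset.mem_Icc.1 hj).1
  rw [coeff_C_mul_X_pow, if_neg (by omega)]

/-- For an odd polynomial of degree greater than `2 * ℓ - 1` with irrational leading coefficient,
suitable maps `φ` give its values at the iterated differences of order `ℓ` an iterated limit
which is nonzero modulo `1`. The coordinate `lam` of that limit only sees the leading term, whatever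
the other coefficients are, since these produce chains `E ^ i * O` with `i < ℓ`. -/
lemma exists_powerFilter_limit_ne_intCast {v : ℝ[X]} (hodd : IsOddPolynomial v) {h ℓ : ℕ}
    (hdeg : v.natDegree = 2 * h + 1) (hℓ : ℓ ≤ h) (hlead : Irrational v.leadingCoeff) :
    ∃ φ : ℕ → Module.End ℚ ℝ, φ 0 = 1 ∧ (∀ j, 1 ≤ j → φ j 1 = 0) ∧
      ∀ n : ℤ, ∑ j ∈ Finset.range (v.natDegree + 1), diffLimit φ ℓ j (v.coeff j) ≠ n := by
  obtain ⟨E, O, lam, hE1, hO1, hlam1, hOE, hOO, hlt, heq⟩ := exists_shift hlead ℓ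
  set b := h - ℓ with hb
  set φ : ℕ → Module.End ℚ ℝ := fun j =>
    if j = 0 then 1 else if j = 2 then E else if j = 2 * b + 1 then O else 0 with hφ
  refine ⟨φ, by simp [hφ], fun j hj => ?_, fun n hn => ?_⟩
  · simp only [hφ, if_neg (show j ≠ 0 by omega)]
    split_ifs <;> simp [hE1, hO1]
  · obtain ⟨e, o, -, -, -, -, hob, hopos, hEl, hOl⟩ :=
      exists_diffLimit_coeff (φ := φ) (E := E) (O := O) (b := b) (by simp [hφ]) (by simp [hφ])
        (by simp only [hφ]; rw [if_neg (by omega), if_neg (by omega)]; simp)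
        (fun j h1 h2 h3 => by simp only [hφ]; rw [if_neg h1, if_neg h2, if_neg h3]) hOE hOO ℓ
    have hterm : ∀ t < h, lam (diffLimit φ ℓ (2 * t + 1) (v.coeff (2 * t + 1))) = 0 := by
      intro t ht
      rw [hOl]
      rcases Nat.lt_or_ge t b with h1 | h1
      · simp [hob t h1]
      · rw [LinearMap.smul_apply, map_smul, Module.End.mul_apply, hlt _ (by omega), smul_zero]
    have htop : lam (diffLimit φ ℓ (2 * h + 1) (v.coeff (2 * h + 1))) = o h := by
      rw [hOl, LinearMap.smul_apply, map_smul, Module.End.mul_apply,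
        show h - b = ℓ by omega, ← hdeg, coeff_natDegree, heq, smul_eq_mul, mul_one]
    -- `lam` vanishes on the integers but not on the limit
    have h1 := congrArg lam hn
    rw [hdeg, show 2 * h + 1 + 1 = 2 * (h + 1) by ring, sum_range_two_mul, map_add, map_sum,
      map_sum, Finset.sum_eq_zero (fun s _ => by rw [hodd.coeff_two_mul, map_zero, map_zero]),
      Finset.sum_range_succ, Finset.sum_eq_zero (fun s hs => hterm s (Finset.mem_range.1 hs)),
      htop, zero_add, zero_add] at h1
    have h2 : lam (n : ℝ) = 0 := by
      have := map_zsmul lam n 1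
      rwa [hlam1, smul_zero, zsmul_eq_mul, mul_one] at this
    rw [h2] at h1
    rw [show b + ℓ = h by omega] at hopos
    exact hopos.ne' h1

/-! ### Conclusion -/

/-- Points close to an integer are close to `1` on the circle. -/
lemma exists_distNearestInt_imp {V : Set Circle} (hV : V ∈ 𝓝 (1 : Circle)) :
    ∃ ε > 0, ∀ x : ℝ, distNearestInt x < ε → Real.fourierChar x ∈ V := by
  have hc : Tendsto (fun x : ℝ => Real.fourierChar x) (𝓝 0) (𝓝 1) := by
    have := Real.continuous_fourierChar.tendsto 0
    rwa [AddChar.map_zero_eq_one] at this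
  obtain ⟨ε, hε, hball⟩ := Metric.mem_nhds_iff.1 (hc hV)
  refine ⟨ε, hε, fun x hx => ?_⟩
  have h1 : x - round x ∈ Metric.ball (0 : ℝ) ε := by
    rw [mem_ball_zero_iff]; exact hx
  have h2 := hball h1
  rwa [Set.mem_preimage, AddChar.map_sub_eq_div, fourierChar_intCast, div_one] at h2

theorem theorem2 (ℓ : ℕ) (hℓ : 1 ≤ ℓ) (v : Polynomial ℝ) (hodd : IsOddPolynomial v)
    (hlead : Irrational v.leadingCoeff)
    (hR : ∀ ε : ℝ, 0 < ε → IsDeltaStar ℓ (returnSet v ε)) :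
    v.natDegree ≤ 2 * ℓ - 1 := by
  by_contra! hdeg
  obtain ⟨h, hh⟩ : ∃ h, v.natDegree = 2 * h + 1 := by
    rcases Nat.even_or_odd' v.natDegree with ⟨h, hh | hh⟩
    · exfalso
      have := hodd.coeff_two_mul h
      rw [← hh, coeff_natDegree] at this
      exact hlead.ne_zero this
    · exact ⟨h, hh⟩
  obtain ⟨φ, hφ0, hφ1, hint⟩ :=
    exists_powerFilter_limit_ne_intCast hodd hh (ℓ := ℓ) (by omega) hlead
  have := powerFilter_neBot (φ := φ) hφ0 hφ1
  set L := ∑ j ∈ Finset.range (v.natDegree + 1), diffLimit φ ℓ j (v.coeff j) with hL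
  have hlim : Tendsto (fun l => Real.fourierChar (v.eval (listDiff ℓ l : ℝ)))
      (listFilter (powerFilter φ) (2 ^ ℓ)) (𝓝 (Real.fourierChar L)) := by
    have h1 := tendsto_fourierChar_sum (Finset.range (v.natDegree + 1)) (fun _ => 1)
      (fun j _ => tendsto_fourierChar_listDiff (tendsto_powerFilter φ) ℓ j (v.coeff j))
    simp only [Int.cast_one, one_mul] at h1
    refine h1.congr fun l => ?_
    rw [eval_eq_sum_range]
    simp only [mul_comm]
  have hne : Real.fourierChar L ≠ 1 := fun h1 => by
    obtain ⟨n, hn⟩ := eq_intCast_of_fourierChar_eq_one h1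
    exact hint n hn
  obtain ⟨U, V, hU, hV, hLU, h1V, hUV⟩ := t2_separation hne
  obtain ⟨ε, hε, hεV⟩ := exists_distNearestInt_imp (hV.mem_nhds h1V)
  obtain ⟨n, hn, hpos, hgood⟩ := exists_strictMono_of_eventually_listFilter
    (powerFilter_le_atTop φ) _ (tendsto_nhds.1 hlim U hU hLU)
  obtain ⟨k, hk, m, hm, hmk⟩ := hR ε hε (fun i => ⟨n i, hpos i⟩) (fun i j hij => hn hij)
  have h1 := hgood k hk
  have h2 : listDiff ℓ (List.ofFn fun i => n (k i)) = ((m : ℕ) : ℤ) := by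
    rw [hmk, listDiff]
    congr 1; ext i
    simp [List.getD_eq_getElem?_getD]
  change Real.fourierChar (v.eval (listDiff ℓ (List.ofFn fun i => n (k i)) : ℝ)) ∈ U at h1
  rw [h2, Int.cast_natCast] at h1
  exact Set.disjoint_left.1 hUV h1 (hεV _ hm)
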